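/- Let $p\in(0,1)$ and put $q=1-p$. For real $r>0$, let $\mathrm{NegBin}(r,p)$ denote the probability distribution on $\mathbb{N}_0=\{0,1,2,\dots\}$ with mass function $$P_{r,p}(k)=\frac{\Gamma(r+k)}{\Gamma(r)\,k!}\,q^r p^k,\qquad k\in\mathbb{N}_0 .$$ Let $K\sim\mathrm{NegBin}(r,p)$ and $U\sim\mathrm{Uniform}(-\tfrac12,\tfrac12)$ be independent, let $X:=K+U$, and let $\mathbb{P}_{r,p}$ and $\widetilde{\mathbb{P}}_{r,p}$ be the laws of $K$ and $X$, respectively. Then, for every $r>0$ and every Borel set $B\subseteq\mathbb{R}$, $$\widetilde{\mathbb{P}}_{r,p}(B)=\int_{\mathbb{N}_0}\int_{(-\frac12,\frac12)}\mathbf{1}_B(k+u)\,\mathrm{d}u\,\mathbb{P}_{r,p}(\mathrm{d}k).$$ Moreover, let $\mathbb{Q}_{r,p}$ be the law of a $\mathrm{Normal}(rpq^{-1},\,rpq^{-2})$ random variable (mean $rpq^{-1}$, variance $rpq^{-2}$). There exist constants $C_p>0$ and $r_p>0$, depending only on $p$, such that for all real $r\ge r_p$, $$\|\widetilde{\mathbb{P}}_{r,p}-\mathbb{Q}_{r,p}\|\le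 C_p\, r^{-1/2},$$ where $\|\cdot\|$ denotes the total variation norm of a finite signed measure, $\|\mu\|=|\mu|(\mathbb{R})$. -/

import Mathlib

open MeasureTheory ProbabilityTheory

/-- The negative binomial mass function
`P_{r,p}(k) = Γ(r + k) / (Γ(r) k!) * (1 - p)^r * p^k`, with real parameter `r > 0`. -/
noncomputable def negBinPMFReal (r p : ℝ) (k : ℕ) : ℝ :=
  Real.Gamma (r + k) / (Real.Gamma r * (k.factorial : ℝ)) * (1 - p) ^ r * p ^ k

/-- The negative binomial distribution `NegBin(r, p)`, as a measure on `ℕ`. -/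
noncomputable def negBinMeasure (r p : ℝ) : Measure ℕ :=
  Measure.sum fun k => ENNReal.ofReal (negBinPMFReal r p k) • Measure.dirac k

/-- The total variation norm `|s|(α)` of a finite signed measure `s`. -/
noncomputable def tvNorm {α : Type*} [MeasurableSpace α] (s : SignedMeasure α) : ℝ :=
  s.totalVariation.real Set.univ

theorem Gamma_add_nat_eq_mul_choose {r : ℝ} (hr : 0 < r) (k : ℕ) :
    Real.Gamma (r + k) / (Real.Gamma r * (k.factorial : ℝ)) = Ring.choose (r + k - 1) k := by
  have hG := (Real.Gamma_pos_of_pos hr).ne'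
  have hk : (k.factorial : ℝ) ≠ 0 := by exact_mod_cast k.factorial_ne_zero
  have h1 : ∀ n : ℕ, Real.Gamma (r + n) = (ascPochhammer ℝ n).eval r * Real.Gamma r := by
    intro n
    induction n with
    | zero => simp
    | succ n ih =>
      have h2 : r + n ≠ 0 := by positivity
      rw [Nat.cast_succ, ← add_assoc, Real.Gamma_add_one h2, ih, ascPochhammer_succ_eval]
      ring
  have h3 := Ring.factorial_nsmul_multichoose_eq_ascPochhammer r k
  rw [Polynomial.ascPochhammer_smeval_eq_eval, nsmul_eq_mul] at h3
  rw [h1, ← h3, ← Ring.multichoose_eq]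
  field_simp

theorem hasSum_negBinPMFReal {r p : ℝ} (hr : 0 < r) (hp0 : 0 < p) (hp1 : p < 1) :
    HasSum (negBinPMFReal r p) 1 := by
  have h := (Real.one_div_one_sub_rpow_hasFPowerSeriesOnBall_zero r).hasSum (y := p)
    (by simpa [← ofReal_norm, abs_of_pos hp0] using hp1)
  have hq : (0 : ℝ) < (1 - p) ^ r := Real.rpow_pos_of_pos (by linarith) r
  have h2 := h.mul_left ((1 - p) ^ r)
  simp only [zero_add, mul_one_div_cancel hq.ne'] at h2
  have h3 : negBinPMFReal r p = fun k => (1 - p) ^ r *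
      (FormalMultilinearSeries.ofScalars ℝ (fun n : ℕ => Ring.choose (r + n - 1) n) k)
        fun _ => p := by
    funext k
    rw [negBinPMFReal, Gamma_add_nat_eq_mul_choose hr]
    simp
    ring
  rw [h3]
  exact h2

theorem isProbabilityMeasure_negBinMeasure {r p : ℝ} (hr : 0 < r) (hp0 : 0 < p) (hp1 : p < 1) :
    IsProbabilityMeasure (negBinMeasure r p) := by
  refine (hasSum_negBinPMFReal hr hp0 hp1).isProbabilityMeasure_sum_dirac fun k => ?_
  have h1 := Real.Gamma_pos_of_pos hr
  have h2 : 0 < Real.Gamma (r + k) := Real.Gamma_pos_of_pos (by positivity)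
  have h3 : (0 : ℝ) ≤ (1 - p) ^ r := Real.rpow_nonneg (by linarith) r
  unfold negBinPMFReal
  positivity

/-! The proof is Stein's method. Put `q = 1 - p`, `m = r p / q`, `v = r p / q ^ 2`, `s = √v`. For
continuous `|h| ≤ 1`, `exists_stein_solution` solves `f' - x f = h - E h(N)`, with `N` standard
normal and bounds on `f`, `f'` uniform in `h`. After rescaling, the error in the expectation of a
test function is that of `v F' - (x - m) F` under the law of `K + U`, with `F = O(1/s)` and `F' =
O(1/v)`.

The uniform noise integrates `F'` over the cell around `k` to exactly `F (k + 1/2) - F (k - 1/2)`,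
so no second derivative is needed. Subtracting the discrete identity `hasSum_negBin_stein` cancels
the leading terms; the rest is at most a multiple of `|k - m| / v + 1 / s`. Since `E |K - m| ≤ s`,
the total is `O(1/s) = O(r ^ (-1/2))` (`abs_sum_stein_operator_le`).

Approximating indicators by continuous functions and using a Hahn decomposition turns this into a
total variation bound. -/

/-! ### Gaussian tails and the normal Stein equation. -/

theorem integrable_exp_neg_half_sq : Integrable fun t : ℝ => Real.exp (-(1 / 2) * t ^ 2) :=
  integrable_exp_neg_mul_sq (by norm_num)

/-- The Mills ratio bound for the Gaussian tail. -/
theorem mul_integral_Ioi_exp_neg_half_sq_le {x : ℝ} (hx : 0 ≤ x) :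
    x * ∫ t in Set.Ioi x, Real.exp (-(1 / 2) * t ^ 2) ≤ Real.exp (-(1 / 2) * x ^ 2) := by
  have hderiv : ∀ t ∈ Set.Ici x, HasDerivAt (fun t : ℝ => -Real.exp (-(1 / 2) * t ^ 2))
      (t * Real.exp (-(1 / 2) * t ^ 2)) t := by
    intro t _
    have h := ((((hasDerivAt_id t).pow 2).const_mul (-(1 / 2) : ℝ)).exp).neg
    refine h.congr_deriv ?_
    simp
    ring
  have hlim : Filter.Tendsto (fun t : ℝ => -Real.exp (-(1 / 2) * t ^ 2)) Filter.atTop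
      (nhds (-0)) := by
    refine (Real.tendsto_exp_atBot.comp ?_).neg
    exact Filter.Tendsto.const_mul_atTop_of_neg (by norm_num)
      (Filter.tendsto_pow_atTop (by norm_num))
  have hpos : ∀ t ∈ Set.Ioi x, 0 ≤ t * Real.exp (-(1 / 2) * t ^ 2) := fun t ht =>
    mul_nonneg (hx.trans (le_of_lt ht)) (Real.exp_pos _).le
  have hint := integrableOn_Ioi_deriv_of_nonneg' hderiv hpos hlim
  have hval := integral_Ioi_of_hasDerivAt_of_nonneg' hderiv hpos hlim
  rw [← integral_const_mul]
  calc _ ≤ ∫ t in Set.Ioi x, t * Real.exp (-(1 / 2) * t ^ 2) := by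
        refine setIntegral_mono_on (integrable_exp_neg_half_sq.integrableOn.const_mul x) hint
          measurableSet_Ioi fun t ht => ?_
        exact mul_le_mul_of_nonneg_right (le_of_lt ht) (Real.exp_pos _).le
    _ = _ := by rw [hval]; ring

/-- The Mills bound degenerates near `0`; on `[0, 1]` the total mass together with `exp (-x ^ 2 / 2)
≥ exp (-1/2)` replaces it. -/
theorem exists_integral_Ioi_exp_neg_half_sq_le :
    ∃ M : ℝ, 1 ≤ M ∧ ∀ x : ℝ, 0 ≤ x → ∫ t in Set.Ioi x, Real.exp (-(1 / 2) * t ^ 2) ≤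
      M * Real.exp (-(1 / 2) * x ^ 2) := by
  set I := ∫ t : ℝ, Real.exp (-(1 / 2) * t ^ 2) with hI
  have hI0 : 0 ≤ I := integral_nonneg fun t => (Real.exp_pos _).le
  refine ⟨1 + I * Real.exp (1 / 2), by
    have := mul_nonneg hI0 (Real.exp_pos (1 / 2)).le; linarith, fun x hx => ?_⟩
  have hT : ∫ t in Set.Ioi x, Real.exp (-(1 / 2) * t ^ 2) ≤ I :=
    setIntegral_le_integral integrable_exp_neg_half_sq
      (Filter.Eventually.of_forall fun t => (Real.exp_pos _).le)
  have hT0 : 0 ≤ ∫ t in Set.Ioi x, Real.exp (-(1 / 2) * t ^ 2) :=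
    integral_nonneg fun t => (Real.exp_pos _).le
  have he := Real.exp_pos (-(1 / 2) * x ^ 2)
  have hm := mul_integral_Ioi_exp_neg_half_sq_le hx
  have hIe : 0 ≤ I * Real.exp (1 / 2) * Real.exp (-(1 / 2) * x ^ 2) := by positivity
  rcases le_total 1 x with h1 | h1
  · nlinarith
  · have : 1 ≤ Real.exp (1 / 2) * Real.exp (-(1 / 2) * x ^ 2) := by
      rw [← Real.exp_add]
      exact Real.one_le_exp (by nlinarith)
    nlinarith

theorem integral_Iic_exp_neg_half_sq (x : ℝ) :
    ∫ t in Set.Iic x, Real.exp (-(1 / 2) * t ^ 2) =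
      ∫ t in Set.Ioi (-x), Real.exp (-(1 / 2) * t ^ 2) := by
  have h := integral_comp_neg_Iic x fun t : ℝ => Real.exp (-(1 / 2) * t ^ 2)
  simpa using h

/-- A bounded mean-zero test function has a primitive against the Gaussian weight which is
dominated by the Gaussian tail. -/
theorem abs_integral_Iic_mul_exp_le {w : ℝ → ℝ} (hw : Continuous w) {D : ℝ} (hD : ∀ x, |w x| ≤ D)
    (h0 : ∫ t, w t * Real.exp (-(1 / 2) * t ^ 2) = 0) (x : ℝ) :
    |∫ t in Set.Iic x, w t * Real.exp (-(1 / 2) * t ^ 2)| ≤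
      D * ∫ t in Set.Ioi |x|, Real.exp (-(1 / 2) * t ^ 2) := by
  have hint : Integrable fun t => w t * Real.exp (-(1 / 2) * t ^ 2) :=
    integrable_exp_neg_half_sq.bdd_mul hw.aestronglyMeasurable
      (Filter.Eventually.of_forall fun t => by simpa using hD t)
  have key : ∀ s : Set ℝ, |∫ t in s, w t * Real.exp (-(1 / 2) * t ^ 2)| ≤
      D * ∫ t in s, Real.exp (-(1 / 2) * t ^ 2) := by
    intro s
    rw [← integral_const_mul]
    refine (abs_integral_le_integral_abs).trans ?_
    refine integral_mono hint.abs.integrableOn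
      (integrable_exp_neg_half_sq.integrableOn.const_mul D) fun t => ?_
    simp only [abs_mul, Real.abs_exp]
    exact mul_le_mul_of_nonneg_right (hD t) (Real.exp_pos _).le
  rcases le_total 0 x with hx | hx
  · have hsplit := intervalIntegral.integral_Iic_add_Ioi (b := x) hint.integrableOn
      hint.integrableOn
    -- Mean zero trades the left integral for the right one, so only the tail pointing away from `0`
    -- is ever estimated.
    have : ∫ t in Set.Iic x, w t * Real.exp (-(1 / 2) * t ^ 2) =
        -∫ t in Set.Ioi x, w t * Real.exp (-(1 / 2) * t ^ 2) := by linarith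
    rw [this, abs_neg, abs_of_nonneg hx]
    exact key _
  · rw [abs_of_nonpos hx, ← integral_Iic_exp_neg_half_sq]
    exact key _

theorem hasDerivAt_integral_Iic {g : ℝ → ℝ} (hg : Continuous g) (hi : Integrable g) (x : ℝ) :
    HasDerivAt (fun x => ∫ t in Set.Iic x, g t) (g x) x := by
  have h : (fun x => ∫ t in Set.Iic x, g t) =
      fun x => (∫ t in Set.Iic 0, g t) + ∫ t in (0 : ℝ)..x, g t := by
    funext y
    have := intervalIntegral.integral_Iic_sub_Iic (a := 0) (b := y) hi.integrableOn hi.integrableOn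
    linarith
  rw [h]
  exact (intervalIntegral.integral_hasDerivAt_right (hg.intervalIntegrable _ _)
    hg.stronglyMeasurable.stronglyMeasurableAtFilter hg.continuousAt).const_add _

theorem integral_mul_exp_eq_zero_of_gaussianReal {w : ℝ → ℝ}
    (h : ∫ x, w x ∂(gaussianReal 0 1) = 0) :
    ∫ t, w t * Real.exp (-(1 / 2) * t ^ 2) = 0 := by
  rw [integral_gaussianReal_eq_integral_smul one_ne_zero] at h
  have h2 : ∫ t, gaussianPDFReal 0 1 t • w t =
      (√(2 * Real.pi))⁻¹ * ∫ t, w t * Real.exp (-(1 / 2) * t ^ 2) := by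
    rw [← integral_const_mul]
    refine integral_congr_ae (Filter.Eventually.of_forall fun t => ?_)
    simp only [gaussianPDFReal, smul_eq_mul, NNReal.coe_one, sub_zero, mul_one]
    rw [show -t ^ 2 / 2 = -(1 / 2) * t ^ 2 by ring]
    ring
  rw [h2] at h
  rcases mul_eq_zero.mp h with h3 | h3
  · exact absurd h3 (by positivity)
  · exact h3

/-- Solution of the Stein equation for a continuous bounded test function, with bounds that are
uniform over the test functions. -/
theorem exists_stein_solution : ∃ M : ℝ, 0 < M ∧ ∀ h : ℝ → ℝ, Continuous h → (∀ x, |h x| ≤ 1) →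
    ∃ f f' : ℝ → ℝ, Continuous f' ∧ (∀ x, HasDerivAt f (f' x) x) ∧ (∀ x, |f x| ≤ M) ∧
      (∀ x, |f' x| ≤ M) ∧ ∀ x, f' x - x * f x = h x - ∫ y, h y ∂(gaussianReal 0 1) := by
  obtain ⟨M, hM1, hM⟩ := exists_integral_Ioi_exp_neg_half_sq_le
  -- The bounds below are `|f| ≤ 2 * M` and `|f'| ≤ |x f| + |w| ≤ 2 + 2`; since `1 ≤ M`, `4 * M`
  -- covers both.
  refine ⟨4 * M, by linarith, fun h hc hb => ?_⟩
  set c := ∫ y, h y ∂(gaussianReal 0 1) with hcdef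
  have hhi : Integrable h (gaussianReal 0 1) :=
    Integrable.of_bound hc.aestronglyMeasurable 1 (Filter.Eventually.of_forall fun t => hb t)
  have hc1 : |c| ≤ 1 := by
    have := norm_integral_le_of_norm_le_const (μ := gaussianReal 0 1) (f := h) (C := 1)
      (Filter.Eventually.of_forall fun t => hb t)
    simpa using this
  set w : ℝ → ℝ := fun x => h x - c with hw
  have hwc : Continuous w := hc.sub continuous_const
  have hwb : ∀ x, |w x| ≤ 2 := fun x => (abs_sub _ _).trans (by linarith [hb x])
  have hw0 : ∫ t, w t * Real.exp (-(1 / 2) * t ^ 2) = 0 := by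
    apply integral_mul_exp_eq_zero_of_gaussianReal
    rw [hw, integral_sub hhi (integrable_const _)]
    simp [hcdef]
  set g : ℝ → ℝ := fun t => w t * Real.exp (-(1 / 2) * t ^ 2) with hg
  have hgc : Continuous g := by fun_prop
  have hgi : Integrable g :=
    integrable_exp_neg_half_sq.bdd_mul hwc.aestronglyMeasurable
      (Filter.Eventually.of_forall fun t => by simpa using hwb t)
  set A : ℝ → ℝ := fun x => ∫ t in Set.Iic x, g t with hA
  have hAd : ∀ x, HasDerivAt A (g x) x := hasDerivAt_integral_Iic hgc hgi
  -- Integrating factor: `(exp (-x ^ 2 / 2) f)' = w exp (-x ^ 2 / 2)`.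
  set f : ℝ → ℝ := fun x => Real.exp ((1 / 2) * x ^ 2) * A x with hf
  have hfd : ∀ x, HasDerivAt f (x * f x + w x) x := by
    intro x
    have h1 : HasDerivAt (fun x : ℝ => Real.exp ((1 / 2) * x ^ 2))
        (x * Real.exp ((1 / 2) * x ^ 2)) x := by
      refine ((((hasDerivAt_id x).pow 2).const_mul (1 / 2 : ℝ)).exp).congr_deriv ?_
      simp
      ring
    refine (h1.mul (hAd x)).congr_deriv ?_
    have h2 : Real.exp ((1 / 2) * x ^ 2) * Real.exp (-(1 / 2) * x ^ 2) = 1 := by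
      rw [← Real.exp_add]; simp
    simp only [hf, hg]
    linear_combination w x * h2
  have hfA : ∀ x, |f x| ≤ Real.exp ((1 / 2) * x ^ 2) *
      (2 * ∫ t in Set.Ioi |x|, Real.exp (-(1 / 2) * t ^ 2)) := by
    intro x
    simp only [hf, abs_mul, Real.abs_exp]
    exact mul_le_mul_of_nonneg_left (abs_integral_Iic_mul_exp_le hwc hwb hw0 x)
      (Real.exp_pos _).le
  have hee : ∀ x : ℝ, Real.exp ((1 / 2) * x ^ 2) * Real.exp (-(1 / 2) * |x| ^ 2) = 1 := by
    intro x
    rw [← Real.exp_add, sq_abs]; simp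
  have hfb : ∀ x, |f x| ≤ 2 * M := by
    intro x
    have h1 := mul_le_mul_of_nonneg_left (hM |x| (abs_nonneg x))
      (Real.exp_pos ((1 / 2) * x ^ 2)).le
    have h2 : Real.exp ((1 / 2) * x ^ 2) * (M * Real.exp (-(1 / 2) * |x| ^ 2)) = M := by
      linear_combination M * hee x
    linarith [hfA x]
  have hxf : ∀ x, |x * f x| ≤ 2 := by
    intro x
    rw [abs_mul]
    have h1 := mul_le_mul_of_nonneg_left (mul_integral_Ioi_exp_neg_half_sq_le (abs_nonneg x))
      (Real.exp_pos ((1 / 2) * x ^ 2)).le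
    have h2 := mul_le_mul_of_nonneg_left (hfA x) (abs_nonneg x)
    linarith [hee x]
  refine ⟨f, fun x => x * f x + w x, ?_, hfd, fun x => ?_, fun x => ?_, fun x => ?_⟩
  · have : Continuous f := continuous_iff_continuousAt.mpr fun x => (hfd x).continuousAt
    fun_prop
  · linarith [hfb x]
  · linarith [abs_add_le (x * f x) (w x), hxf x, hwb x]
  · simp [hw]

/-! ### Moments and Stein identity of the negative binomial law. -/

theorem HasSum.of_eq_of_eq {ι : Type*} {f g : ι → ℝ} {a b : ℝ} (h : HasSum f a)
    (hfg : ∀ i, g i = f i) (hab : b = a) : HasSum g b := by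
  rwa [hab, funext hfg]

theorem negBinPMFReal_nonneg {r p : ℝ} (hr : 0 < r) (hp0 : 0 < p) (hp1 : p < 1) (k : ℕ) :
    0 ≤ negBinPMFReal r p k := by
  have h1 := Real.Gamma_pos_of_pos hr
  have h2 : 0 < Real.Gamma (r + k) := Real.Gamma_pos_of_pos (by positivity)
  have h3 : (0 : ℝ) ≤ (1 - p) ^ r := Real.rpow_nonneg (by linarith) r
  unfold negBinPMFReal
  positivity

theorem negBinPMFReal_succ {r p : ℝ} (hr : 0 < r) (k : ℕ) :
    (k + 1) * negBinPMFReal r p (k + 1) = p * (r + k) * negBinPMFReal r p k := by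
  have h1 := (Real.Gamma_pos_of_pos hr).ne'
  have hk : (k.factorial : ℝ) ≠ 0 := by exact_mod_cast k.factorial_ne_zero
  have h2 : r + k ≠ 0 := by positivity
  have h3 : (k : ℝ) + 1 ≠ 0 := by positivity
  unfold negBinPMFReal
  rw [Nat.factorial_succ, Nat.cast_mul, Nat.cast_succ, ← add_assoc, Real.Gamma_add_one h2]
  field_simp
  ring

/-- Size biasing raises the shape parameter by one. -/
theorem add_mul_negBinPMFReal {r p : ℝ} (hr : 0 < r) (hp1 : p < 1) (k : ℕ) :
    (r + k) * negBinPMFReal r p k = r / (1 - p) * negBinPMFReal (r + 1) p k := by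
  have h1 := (Real.Gamma_pos_of_pos hr).ne'
  have hk : (k.factorial : ℝ) ≠ 0 := by exact_mod_cast k.factorial_ne_zero
  have h2 : r + k ≠ 0 := by positivity
  have hq : (1 - p) ≠ 0 := by linarith
  unfold negBinPMFReal
  rw [add_right_comm r 1 (k : ℝ), Real.Gamma_add_one h2, Real.Gamma_add_one hr.ne',
    Real.rpow_add (by linarith), Real.rpow_one]
  field_simp

theorem hasSum_add_mul_negBinPMFReal {r p : ℝ} (hr : 0 < r) (hp0 : 0 < p) (hp1 : p < 1) :
    HasSum (fun k : ℕ => (r + k) * negBinPMFReal r p k) (r / (1 - p)) := by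
  simp_rw [add_mul_negBinPMFReal hr hp1]
  simpa using (hasSum_negBinPMFReal (r := r + 1) (by linarith) hp0 hp1).mul_left (r / (1 - p))

theorem hasSum_add_mul_add_mul_negBinPMFReal {r p : ℝ} (hr : 0 < r) (hp0 : 0 < p) (hp1 : p < 1) :
    HasSum (fun k : ℕ => (r + 1 + k) * ((r + k) * negBinPMFReal r p k))
      (r / (1 - p) * ((r + 1) / (1 - p))) := by
  simp_rw [add_mul_negBinPMFReal hr hp1]
  refine ((hasSum_add_mul_negBinPMFReal (r := r + 1) (by linarith) hp0 hp1).mul_left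
    (r / (1 - p))).of_eq_of_eq (fun k => ?_) rfl
  ring

/-- The variance of the negative binomial distribution. -/
theorem hasSum_sub_sq_mul_negBinPMFReal {r p : ℝ} (hr : 0 < r) (hp0 : 0 < p) (hp1 : p < 1) :
    HasSum (fun k : ℕ => (k - r * p / (1 - p)) ^ 2 * negBinPMFReal r p k)
      (r * p / (1 - p) ^ 2) := by
  have hq : (1 - p) ≠ 0 := by linarith
  have h0 := hasSum_negBinPMFReal hr hp0 hp1
  have h1 := hasSum_add_mul_negBinPMFReal hr hp0 hp1
  have h2 := hasSum_add_mul_add_mul_negBinPMFReal hr hp0 hp1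
  -- With `y = r + k`, `k - m = y - r / q`, whose square is `(y + 1) y - (1 + 2 r / q) y + (r / q) ^
  -- 2`.
  refine ((h2.sub (h1.mul_left (1 + 2 * r / (1 - p)))).add
    (h0.mul_left ((r / (1 - p)) ^ 2))).of_eq_of_eq (fun k => ?_) ?_
  · field_simp
    ring
  · field_simp
    ring

theorem summable_mul_negBinPMFReal {r p : ℝ} (hr : 0 < r) (hp0 : 0 < p) (hp1 : p < 1)
    {c : ℕ → ℝ} {D : ℝ} (hc : ∀ k, |c k| ≤ D * (r + k)) :
    Summable fun k : ℕ => c k * negBinPMFReal r p k := by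
  refine Summable.of_norm_bounded
    ((hasSum_add_mul_negBinPMFReal hr hp0 hp1).summable.mul_left D) fun k => ?_
  rw [Real.norm_eq_abs, abs_mul, abs_of_nonneg (negBinPMFReal_nonneg hr hp0 hp1 k), ← mul_assoc]
  exact mul_le_mul_of_nonneg_right (hc k) (negBinPMFReal_nonneg hr hp0 hp1 k)

/-- The Stein identity of the negative binomial distribution. -/
theorem hasSum_negBin_stein {r p : ℝ} (hr : 0 < r) (hp0 : 0 < p) (hp1 : p < 1)
    {g : ℕ → ℝ} {D : ℝ} (hg : ∀ k, |g k| ≤ D) :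
    HasSum (fun k : ℕ => (p * (r + k) * g (k + 1) - k * g k) * negBinPMFReal r p k) 0 := by
  have hs : Summable fun k : ℕ => (k * g k) * negBinPMFReal r p k := by
    refine summable_mul_negBinPMFReal hr hp0 hp1 (D := D) fun k => ?_
    have hD : 0 ≤ D := (abs_nonneg _).trans (hg 0)
    rw [abs_mul, Nat.abs_cast, mul_comm]
    have hk : (0 : ℝ) ≤ k := by positivity
    nlinarith [hg k, mul_nonneg hD hr.le, mul_le_mul_of_nonneg_right (hg k) hk]
  -- The `k = 0` term vanishes, so the index shifts freely and the recursion for the mass function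
  -- applies.
  have h1 := (hasSum_nat_add_iff' (f := fun k : ℕ => (k * g k) * negBinPMFReal r p k) 1).mpr
    hs.hasSum
  simp only [Finset.range_one, Finset.sum_singleton, Nat.cast_zero, zero_mul, sub_zero] at h1
  refine (h1.sub hs.hasSum).of_eq_of_eq (fun k => ?_) ?_
  · push_cast
    linear_combination (-g (k + 1)) * negBinPMFReal_succ (p := p) hr k
  · ring

/-! ### Comparison of the continuous and discrete Stein operators. -/

/-- The integrand differs from its frozen value by `(k - m) (F x - F (k - 1/2)) + (x - k) F x`,
where `F` moves by at most `B` over the unit cell and `|x - k| ≤ 1/2`. Freezing at the left endpoint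
matches the samples in the discrete identity. -/
theorem abs_integral_cell_sub_le {F F' : ℝ → ℝ} {A B m : ℝ} (hF : ∀ x, HasDerivAt F (F' x) x)
    (hA : ∀ x, |F x| ≤ A) (hB : ∀ x, |F' x| ≤ B) (k : ℝ) :
    |(∫ x in (k - 1 / 2)..(k + 1 / 2), (x - m) * F x) - (k - m) * F (k - 1 / 2)| ≤
      B * |k - m| + A / 2 := by
  have hFc : Continuous F := continuous_iff_continuousAt.mpr fun x => (hF x).continuousAt
  have h1 : (∫ x in (k - 1 / 2)..(k + 1 / 2), (x - m) * F x) - (k - m) * F (k - 1 / 2) =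
      ∫ x in (k - 1 / 2)..(k + 1 / 2), ((x - m) * F x - (k - m) * F (k - 1 / 2)) := by
    rw [intervalIntegral.integral_sub (Continuous.intervalIntegrable (by fun_prop) _ _)
      (Continuous.intervalIntegrable (by fun_prop) _ _), intervalIntegral.integral_const,
      smul_eq_mul]
    ring
  rw [h1]
  have h2 := intervalIntegral.norm_integral_le_of_norm_le_const (a := k - 1 / 2) (b := k + 1 / 2)
    (f := fun x => (x - m) * F x - (k - m) * F (k - 1 / 2)) (C := B * |k - m| + A / 2) ?_
  · rw [Real.norm_eq_abs] at h2
    convert h2 using 1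
    rw [show k + 1 / 2 - (k - 1 / 2) = 1 by ring]
    simp
  · intro x hx
    rw [Set.uIoc_of_le (by linarith)] at hx
    have h3 : |F x - F (k - 1 / 2)| ≤ B * |x - (k - 1 / 2)| :=
      convex_univ.norm_image_sub_le_of_norm_hasDerivWithin_le (f := F) (f' := F')
        (fun x _ => (hF x).hasDerivWithinAt) (fun x _ => hB x) (Set.mem_univ _) (Set.mem_univ _)
    have hB0 : 0 ≤ B := (abs_nonneg _).trans (hB 0)
    have h4 : |x - (k - 1 / 2)| ≤ 1 := abs_le.mpr ⟨by linarith [hx.1], by linarith [hx.2]⟩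
    have h5 : |x - k| ≤ 1 / 2 := abs_le.mpr ⟨by linarith [hx.1], by linarith [hx.2]⟩
    have h6 : |F x - F (k - 1 / 2)| ≤ B := h3.trans (by nlinarith)
    have h7 : |(x - k) * F x| ≤ A / 2 := by
      rw [abs_mul]
      have := mul_le_mul h5 (hA x) (abs_nonneg _) (by norm_num)
      linarith
    have h8 : |(k - m) * (F x - F (k - 1 / 2))| ≤ B * |k - m| := by
      rw [abs_mul, mul_comm]
      exact mul_le_mul_of_nonneg_right h6 (abs_nonneg _)
    rw [Real.norm_eq_abs, show (x - m) * F x - (k - m) * F (k - 1 / 2) =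
      (k - m) * (F x - F (k - 1 / 2)) + (x - k) * F x by ring]
    exact (abs_add_le _ _).trans (add_le_add h8 h7)

/-- The Gaussian Stein operator has small expectation under a negative binomial law convolved
with the uniform distribution. -/
theorem abs_sum_stein_operator_le {r p : ℝ} (hr : 0 < r) (hp0 : 0 < p) (hp1 : p < 1)
    {F F' : ℝ → ℝ} {A B S : ℝ} (hF : ∀ x, HasDerivAt F (F' x) x) (hF' : Continuous F')
    (hA : ∀ x, |F x| ≤ A) (hB : ∀ x, |F' x| ≤ B)
    (hS : HasSum (fun k : ℕ => (∫ x in ((k : ℝ) - 1 / 2)..((k : ℝ) + 1 / 2),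
      (r * p / (1 - p) ^ 2 * F' x - (x - r * p / (1 - p)) * F x)) * negBinPMFReal r p k) S) :
    |S| ≤ B / (1 - p) * √(r * p / (1 - p) ^ 2) + A / 2 := by
  have hq : 0 < 1 - p := by linarith
  have hv : 0 < r * p / (1 - p) ^ 2 := by positivity
  have hB0 : 0 ≤ B := (abs_nonneg _).trans (hB 0)
  have hFc : Continuous F := continuous_iff_continuousAt.mpr fun x => (hF x).continuousAt
  set v := r * p / (1 - p) ^ 2 with hvdef
  set m := r * p / (1 - p) with hmdef
  set s := √v with hs
  have hs0 : 0 < s := Real.sqrt_pos.mpr hv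
  have hss : s ^ 2 = v := Real.sq_sqrt hv.le
  -- With this `g`, the increment `g (k + 1) - g k` is the integral of `F'` over the cell of `k`.
  have hstein := (hasSum_negBin_stein hr hp0 hp1 (g := fun k : ℕ => F (k - 1 / 2))
    fun k => hA _).mul_left (1 / (1 - p))
  have hbound := ((hasSum_negBinPMFReal hr hp0 hp1).mul_left (B / (1 - p) * (s / 2) + A / 2)).add
    ((hasSum_sub_sq_mul_negBinPMFReal hr hp0 hp1).mul_left (B / (1 - p) / (2 * s)))
  have hmain := (hS.sub hstein).norm_le_of_bounded hbound ?_
  · rw [mul_zero, sub_zero, Real.norm_eq_abs] at hmain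
    refine hmain.trans (le_of_eq ?_)
    rw [← hvdef, ← hss]
    field_simp
    ring
  · intro k
    have hP := negBinPMFReal_nonneg hr hp0 hp1 k
    have hcell := abs_integral_cell_sub_le hF hA hB (m := m) k
    have hFTC : ∫ x in ((k : ℝ) - 1 / 2)..((k : ℝ) + 1 / 2), F' x =
        F (k + 1 / 2) - F (k - 1 / 2) :=
      intervalIntegral.integral_eq_sub_of_hasDerivAt (fun x _ => hF x)
        (hF'.intervalIntegrable _ _)
    have hinc : |F (k + 1 / 2) - F (k - 1 / 2)| ≤ B := by
      have := convex_univ.norm_image_sub_le_of_norm_hasDerivWithin_le (f := F) (f' := F')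
        (fun x _ => (hF x).hasDerivWithinAt) (fun x _ => hB x) (Set.mem_univ ((k : ℝ) - 1 / 2))
        (Set.mem_univ ((k : ℝ) + 1 / 2))
      rwa [show (k : ℝ) + 1 / 2 - (k - 1 / 2) = 1 by ring, norm_one, mul_one] at this
    have hint : ∫ x in ((k : ℝ) - 1 / 2)..((k : ℝ) + 1 / 2), (v * F' x - (x - m) * F x) =
        v * (F (k + 1 / 2) - F (k - 1 / 2)) -
          ∫ x in ((k : ℝ) - 1 / 2)..((k : ℝ) + 1 / 2), (x - m) * F x := by
      rw [intervalIntegral.integral_sub (Continuous.intervalIntegrable (by fun_prop) _ _)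
        (Continuous.intervalIntegrable (by fun_prop) _ _), intervalIntegral.integral_const_mul,
        hFTC]
    rw [hint, ← mul_assoc, ← sub_mul, norm_mul, Real.norm_eq_abs, Real.norm_eq_abs,
      abs_of_nonneg hP, ← mul_assoc, ← add_mul]
    refine mul_le_mul_of_nonneg_right ?_ hP
    set E := (∫ x in ((k : ℝ) - 1 / 2)..((k : ℝ) + 1 / 2), (x - m) * F x) -
      (k - m) * F (k - 1 / 2) with hE
    set d := F (k + 1 / 2) - F (k - 1 / 2) with hd
    -- Uses `p (r + k) / q = v + (p / q) (k - m)` and `p (r + k) - k = -q (k - m)`.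
    have hsplit : v * d - (∫ x in ((k : ℝ) - 1 / 2)..((k : ℝ) + 1 / 2), (x - m) * F x) -
        1 / (1 - p) * (p * (r + k) * F ((k + 1 : ℕ) - 1 / 2) - k * F (k - 1 / 2)) =
        -(p / (1 - p) * ((k - m) * d)) - E := by
      rw [hE, hd, show ((k + 1 : ℕ) : ℝ) - 1 / 2 = k + 1 / 2 by push_cast; ring, hvdef, hmdef]
      field_simp
      ring
    rw [hsplit]
    have h1 : |-(p / (1 - p) * ((k - m) * d))| ≤ p / (1 - p) * (B * |k - m|) := by
      rw [abs_neg, abs_mul, abs_mul, abs_of_nonneg (by positivity : 0 ≤ p / (1 - p))]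
      refine mul_le_mul_of_nonneg_left ?_ (by positivity)
      rw [mul_comm]
      exact mul_le_mul_of_nonneg_right hinc (abs_nonneg _)
    -- AM-GM weighted so that, the variance being `s ^ 2`, the right side has expectation exactly
    -- `s`.
    have h2 : |(k : ℝ) - m| ≤ s / 2 + (k - m) ^ 2 / (2 * s) := by
      rw [div_add_div _ _ two_ne_zero (by positivity), le_div_iff₀ (by positivity), ← sq_abs (_ - m)]
      nlinarith [sq_nonneg (|(k : ℝ) - m| - s)]
    calc _ ≤ p / (1 - p) * (B * |k - m|) + (B * |k - m| + A / 2) :=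
          (abs_sub _ _).trans (add_le_add h1 hcell)
      _ = B / (1 - p) * |k - m| + A / 2 := by field_simp; ring
      _ ≤ B / (1 - p) * (s / 2 + (k - m) ^ 2 / (2 * s)) + A / 2 := by gcongr
      _ = _ := by ring

/-! ### From continuous test functions to total variation. -/

/-- The norm is the difference of the values on a Hahn set and on its complement, each at most `ε`
in absolute value. -/
theorem tvNorm_toSignedMeasure_sub_le {α : Type*} [MeasurableSpace α] {μ ν : Measure α}
    [IsFiniteMeasure μ] [IsFiniteMeasure ν] {ε : ℝ}
    (h : ∀ B, MeasurableSet B → |μ.real B - ν.real B| ≤ ε) :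
    tvNorm (μ.toSignedMeasure - ν.toSignedMeasure) ≤ 2 * ε := by
  obtain ⟨i, hi, hi2, hi3, hpos, hneg⟩ :=
    (μ.toSignedMeasure - ν.toSignedMeasure).toJordanDecomposition_spec
  rw [tvNorm, SignedMeasure.totalVariation, measureReal_add_apply, hpos, hneg,
    SignedMeasure.toMeasureOfZeroLE_real_apply _ hi2 hi MeasurableSet.univ,
    SignedMeasure.toMeasureOfLEZero_real_apply _ hi3 hi.compl MeasurableSet.univ,
    Set.inter_univ, Set.inter_univ, Measure.toSignedMeasure_sub_apply hi,
    Measure.toSignedMeasure_sub_apply hi.compl]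
  have h1 := (abs_le.mp (h i hi)).2
  have h2 := (abs_le.mp (h iᶜ hi.compl)).1
  linarith

theorem abs_measureReal_sub_le_of_continuous {μ ν : Measure ℝ} [IsFiniteMeasure μ]
    [IsFiniteMeasure ν] {ε : ℝ}
    (h : ∀ f : ℝ → ℝ, Continuous f → (∀ x, |f x| ≤ 1) → |∫ x, f x ∂μ - ∫ x, f x ∂ν| ≤ ε)
    {B : Set ℝ} (hB : MeasurableSet B) : |μ.real B - ν.real B| ≤ ε := by
  refine le_of_forall_pos_le_add fun δ hδ => ?_
  set ι : ℝ → ℝ := B.indicator fun _ => 1 with hι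
  have hιi : ∀ ρ : Measure ℝ, IsFiniteMeasure ρ → Integrable ι ρ := fun ρ _ =>
    (integrable_const 1).indicator hB
  -- Approximating in `L¹(μ + ν)` controls both errors by a single `δ`.
  obtain ⟨g, hg, -⟩ := (hιi (μ + ν) inferInstance).exists_boundedContinuous_integral_sub_le hδ
  -- Clamping to `[-1, 1]` is 1-Lipschitz and fixes the indicator, so it cannot worsen the
  -- approximation.
  set f : ℝ → ℝ := fun x => max (min (g x) 1) (-1) with hf
  have hfc : Continuous f := by have := g.continuous; fun_prop
  have hfb : ∀ x, |f x| ≤ 1 := fun x =>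
    abs_le.mpr ⟨le_max_right _ _, max_le (min_le_right _ _) (by norm_num)⟩
  have hfi : ∀ ρ : Measure ℝ, IsFiniteMeasure ρ → Integrable f ρ := fun ρ _ =>
    Integrable.of_bound hfc.aestronglyMeasurable 1 (Filter.Eventually.of_forall fun t => hfb t)
  have hgi : ∀ ρ : Measure ℝ, IsFiniteMeasure ρ → Integrable g ρ := fun ρ _ => g.integrable ρ
  have hle : ∀ x, |ι x - f x| ≤ ‖ι x - g x‖ := by
    intro x
    have h1 : ι x = max (min (ι x) 1) (-1) := by
      by_cases hx : x ∈ B <;> simp [hι, hx]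
    rw [h1, Real.norm_eq_abs, ← h1]
    exact (congrArg (fun y => |y - f x|) h1).trans_le <| (abs_max_sub_max_le_abs _ _ _).trans <| by
      simpa [hf] using abs_min_sub_min_le_max (ι x) 1 (g x) 1
  have hdiff : ∀ ρ : Measure ℝ, IsFiniteMeasure ρ →
      |ρ.real B - ∫ x, f x ∂ρ| ≤ ∫ x, ‖ι x - g x‖ ∂ρ := by
    intro ρ hρ
    rw [show ρ.real B = ∫ x, ι x ∂ρ by rw [hι, integral_indicator_const _ hB]; simp,
      ← integral_sub (hιi ρ hρ) (hfi ρ hρ)]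
    exact abs_integral_le_integral_abs.trans
      (integral_mono ((hιi ρ hρ).sub (hfi ρ hρ)).abs ((hιi ρ hρ).sub (hgi ρ hρ)).norm hle)
  have hadd : ∫ x, ‖ι x - g x‖ ∂(μ + ν) = ∫ x, ‖ι x - g x‖ ∂μ + ∫ x, ‖ι x - g x‖ ∂ν :=
    integral_add_measure ((hιi μ inferInstance).sub (hgi μ inferInstance)).norm
      ((hιi ν inferInstance).sub (hgi ν inferInstance)).norm
  have h1 := abs_le.mp (hdiff μ inferInstance)
  have h2 := abs_le.mp (hdiff ν inferInstance)
  have h3 := abs_le.mp (h f hfc hfb)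
  exact abs_le.mpr ⟨by linarith, by linarith⟩

/-! ### The law of `K + U` and its integrals over unit cells. -/

theorem map_natCast_add_uniform_eq {Ω : Type*} [MeasurableSpace Ω] {P : Measure Ω}
    [IsProbabilityMeasure P] {K : Ω → ℕ} {U : Ω → ℝ} {κ : Measure ℕ} (hK : HasLaw K κ P)
    (hU : AEMeasurable U P) (hU2 : pdf.IsUniform U (Set.Ioo (-1 / 2 : ℝ) (1 / 2)) P volume)
    (hKU : IndepFun K U P) :
    P.map (fun ω => (K ω : ℝ) + U ω) =
      (κ.prod (volume.restrict (Set.Ioo (-1 / 2 : ℝ) (1 / 2)))).map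
        fun z => (z.1 : ℝ) + z.2 := by
  -- The interval has length one, so conditioning on it needs no normalisation.
  have hV : P.map U = volume.restrict (Set.Ioo (-1 / 2 : ℝ) (1 / 2)) := by
    rw [hU2, ProbabilityTheory.cond, Real.volume_Ioo]
    norm_num
  rw [← hV, ← hK.map_eq, ← hKU.map_prod_eq_prod_map_map hK.aemeasurable hU,
    AEMeasurable.map_map_of_aemeasurable (by fun_prop) (hK.aemeasurable.prodMk hU)]
  rfl

theorem map_natCast_add_apply {κ : Measure ℕ} {ρ : Measure ℝ} [SFinite ρ] {B : Set ℝ}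
    (hB : MeasurableSet B) :
    (κ.prod ρ).map (fun z => (z.1 : ℝ) + z.2) B =
      ∫⁻ k, ∫⁻ u, B.indicator (fun _ => 1) ((k : ℝ) + u) ∂ρ ∂κ := by
  have hm : Measurable fun z : ℕ × ℝ => (z.1 : ℝ) + z.2 := by fun_prop
  have hi : Measurable (B.indicator fun _ => (1 : ENNReal)) := measurable_const.indicator hB
  refine Eq.trans ?_ (lintegral_prod _ (hi.comp hm).aemeasurable)
  simp only [Function.comp_apply]
  rw [← lintegral_map hi hm, lintegral_indicator hB]
  simp

theorem hasSum_integral_map_natCast_add_uniform {a : ℕ → ℝ} (ha0 : ∀ k, 0 ≤ a k)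
    (ha : HasSum a 1) {h : ℝ → ℝ} (hc : Continuous h) (hb : ∀ x, |h x| ≤ 1) :
    HasSum (fun k : ℕ => (∫ x in ((k : ℝ) - 1 / 2)..((k : ℝ) + 1 / 2), h x) * a k)
      (∫ x, h x ∂((Measure.sum fun k => ENNReal.ofReal (a k) • Measure.dirac k).prod
        (volume.restrict (Set.Ioo (-1 / 2 : ℝ) (1 / 2)))).map fun z => (z.1 : ℝ) + z.2) := by
  set κ : Measure ℕ := Measure.sum fun k => ENNReal.ofReal (a k) • Measure.dirac k with hκ
  have hκp : IsProbabilityMeasure κ := ha.isProbabilityMeasure_sum_dirac ha0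
  have hm : Measurable fun z : ℕ × ℝ => (z.1 : ℝ) + z.2 := by fun_prop
  have hcell : ∀ k : ℕ, ∫ u in Set.Ioo (-1 / 2 : ℝ) (1 / 2), h ((k : ℝ) + u) =
      ∫ x in ((k : ℝ) - 1 / 2)..((k : ℝ) + 1 / 2), h x := by
    intro k
    rw [← integral_Ioc_eq_integral_Ioo, ← intervalIntegral.integral_of_le (by norm_num),
      intervalIntegral.integral_comp_add_left]
    congr 1
    ring
  have hcb : ∀ k : ℕ, |∫ x in ((k : ℝ) - 1 / 2)..((k : ℝ) + 1 / 2), h x| ≤ 1 := by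
    intro k
    have := intervalIntegral.norm_integral_le_of_norm_le_const (a := (k : ℝ) - 1 / 2)
      (b := (k : ℝ) + 1 / 2) (f := h) (C := 1) fun x _ => hb x
    rwa [show (k : ℝ) + 1 / 2 - (k - 1 / 2) = 1 by ring, abs_one, mul_one] at this
  rw [integral_map hm.aemeasurable hc.aestronglyMeasurable, integral_prod]
  · simp_rw [hcell]
    have := hasSum_integral_sum_dirac (x := fun k : ℕ => k) (c := fun k => ENNReal.ofReal (a k))
      (f := fun k : ℕ => ∫ x in ((k : ℝ) - 1 / 2)..((k : ℝ) + 1 / 2), h x) (by simp) ?_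
    · simpa [ENNReal.toReal_ofReal, ha0, mul_comm] using this
    · refine Summable.of_nonneg_of_le (fun k => by positivity) (fun k => ?_) ha.summable
      rw [ENNReal.toReal_ofReal (ha0 k)]
      exact mul_le_of_le_one_right (ha0 k) (hcb k)
  · exact Integrable.of_bound (hc.measurable.comp hm).aestronglyMeasurable 1
      (Filter.Eventually.of_forall fun t => hb _)

theorem integral_gaussianReal_comp_affine (m : ℝ) {v : ℝ} (hv : 0 ≤ v) {h : ℝ → ℝ}
    (hc : Continuous h) :
    ∫ y, h (√v * y + m) ∂(gaussianReal 0 1) = ∫ x, h x ∂(gaussianReal m v.toNNReal) := by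
  have h1 : (gaussianReal 0 1).map (fun y => √v * y + m) = gaussianReal m v.toNNReal := by
    have h2 : (fun y : ℝ => √v * y + m) = (fun y => y + m) ∘ fun y => √v * y := rfl
    rw [h2, ← Measure.map_map (by fun_prop) (by fun_prop), gaussianReal_map_const_mul,
      gaussianReal_map_add_const]
    congr 1
    · simp
    · ext
      simp [Real.sq_sqrt hv, hv]
  rw [← h1, integral_map (by fun_prop) hc.aestronglyMeasurable]

/-! ### The quantitative estimate and the conclusion. -/

theorem exists_abs_integral_negBin_sub_integral_gaussian_le {p : ℝ} (hp0 : 0 < p) (hp1 : p < 1) :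
    ∃ C : ℝ, 0 < C ∧ ∀ r : ℝ, 0 < r → ∀ h : ℝ → ℝ, Continuous h → (∀ x, |h x| ≤ 1) →
      |∫ x, h x ∂((negBinMeasure r p).prod
          (volume.restrict (Set.Ioo (-1 / 2 : ℝ) (1 / 2)))).map (fun z => (z.1 : ℝ) + z.2) -
        ∫ x, h x ∂(gaussianReal (r * p / (1 - p)) (Real.toNNReal (r * p / (1 - p) ^ 2)))| ≤
      C * r ^ (-(1 / 2) : ℝ) := by
  obtain ⟨M, hM0, hM⟩ := exists_stein_solution
  have hq : 0 < 1 - p := by linarith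
  -- This is `B s / q + A / 2` for `A = M / s`, `B = M / v`, with `1 / s = (q / √p) r ^ (-1/2)`.
  refine ⟨M * (1 / (1 - p) + 1 / 2) * ((1 - p) / √p), by positivity, fun r hr h hc hb => ?_⟩
  set v := r * p / (1 - p) ^ 2 with hvdef
  set m := r * p / (1 - p) with hmdef
  have hv : 0 < v := by positivity
  set s := √v with hs
  have hs0 : 0 < s := Real.sqrt_pos.mpr hv
  have hss : s ^ 2 = v := Real.sq_sqrt hv.le
  have hs_inv : 1 / s = (1 - p) / √p * r ^ (-(1 / 2) : ℝ) := by
    rw [Real.rpow_neg hr.le, ← Real.sqrt_eq_rpow, hs, hvdef, Real.sqrt_div (by positivity),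
      Real.sqrt_mul hr.le, Real.sqrt_sq hq.le]
    field_simp
  obtain ⟨f, f', hf'c, hfd, hfM, hf'M, heq⟩ := hM (fun y => h (s * y + m)) (by fun_prop)
    fun y => hb _
  rw [integral_gaussianReal_comp_affine m hv.le hc] at heq
  set c := ∫ x, h x ∂(gaussianReal m v.toNNReal) with hcdef
  have hFd : ∀ x, HasDerivAt (fun x => f ((x - m) / s) / s) (f' ((x - m) / s) / v) x := by
    intro x
    have h1 := ((hfd ((x - m) / s)).comp x (((hasDerivAt_id x).sub_const m).div_const s)).div_const s
    refine h1.congr_deriv ?_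
    rw [← hss]
    field_simp
  have hS : HasSum (fun k : ℕ => (∫ x in ((k : ℝ) - 1 / 2)..((k : ℝ) + 1 / 2),
      (v * (f' ((x - m) / s) / v) - (x - m) * (f ((x - m) / s) / s))) * negBinPMFReal r p k)
      ((∫ x, h x ∂((negBinMeasure r p).prod
          (volume.restrict (Set.Ioo (-1 / 2 : ℝ) (1 / 2)))).map (fun z => (z.1 : ℝ) + z.2)) - c) := by
    refine ((hasSum_integral_map_natCast_add_uniform (negBinPMFReal_nonneg hr hp0 hp1)
      (hasSum_negBinPMFReal hr hp0 hp1) hc hb).sub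
      ((hasSum_negBinPMFReal hr hp0 hp1).mul_left c)).of_eq_of_eq (fun k => ?_) (by
        rw [mul_one]; rfl)
    rw [← sub_mul]
    congr 1
    have h1 : ∀ x, v * (f' ((x - m) / s) / v) - (x - m) * (f ((x - m) / s) / s) = h x - c := by
      intro x
      have h2 := heq ((x - m) / s)
      rw [mul_div_cancel₀ _ hs0.ne', sub_add_cancel] at h2
      rw [← h2]
      field_simp
    simp_rw [h1]
    rw [intervalIntegral.integral_sub (hc.intervalIntegrable _ _)
      (Continuous.intervalIntegrable (by fun_prop) _ _), intervalIntegral.integral_const,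
      show (k : ℝ) + 1 / 2 - (k - 1 / 2) = 1 by ring, one_smul]
  have hfin := abs_sum_stein_operator_le hr hp0 hp1 (A := M / s) (B := M / v) hFd
    (by fun_prop)
    (fun x => by rw [abs_div, abs_of_pos hs0]; gcongr; exact hfM _)
    (fun x => by rw [abs_div, abs_of_pos hv]; gcongr; exact hf'M _) hS
  refine hfin.trans (le_of_eq ?_)
  rw [mul_assoc, ← hs_inv, ← hvdef, ← hs, ← hss]
  field_simp

theorem mainTheorem5 (p : ℝ) (hp0 : 0 < p) (hp1 : p < 1) :
    ∃ C : ℝ, 0 < C ∧ ∃ r₀ : ℝ, 0 < r₀ ∧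
      ∀ (r : ℝ), 0 < r →
        ∀ (Ω : Type*) [MeasurableSpace Ω] (P : Measure Ω) [IsProbabilityMeasure P]
          (K : Ω → ℕ) (U : Ω → ℝ),
          HasLaw K (negBinMeasure r p) P →
          AEMeasurable U P →
          pdf.IsUniform U (Set.Ioo (-1 / 2 : ℝ) (1 / 2)) P volume →
          IndepFun K U P →
          (∀ B : Set ℝ, MeasurableSet B →
            P.map (fun ω => (K ω : ℝ) + U ω) B =
              ∫⁻ k : ℕ, ∫⁻ u in Set.Ioo (-1 / 2 : ℝ) (1 / 2),
                B.indicator (fun _ => 1) ((k : ℝ) + u) ∂volume ∂(negBinMeasure r p)) ∧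
          (r₀ ≤ r →
            tvNorm ((P.map (fun ω => (K ω : ℝ) + U ω)).toSignedMeasure -
                (gaussianReal (r * p / (1 - p))
                  (Real.toNNReal (r * p / (1 - p) ^ 2))).toSignedMeasure) ≤
              C * r ^ (-(1 / 2) : ℝ)) := by
  obtain ⟨C, hC, hmain⟩ := exists_abs_integral_negBin_sub_integral_gaussian_le hp0 hp1
  -- The estimate holds for all `r > 0`, so the threshold `1` is arbitrary; the `2` comes from the
  -- two Hahn pieces.
  refine ⟨2 * C, by positivity, 1, one_pos, fun r hr Ω _ P _ K U hK hU hU2 hKU => ⟨?_, fun _ => ?_⟩⟩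
  · intro B hB
    rw [map_natCast_add_uniform_eq hK hU hU2 hKU, map_natCast_add_apply hB]
  · have : IsProbabilityMeasure (P.map fun ω => (K ω : ℝ) + U ω) :=
      Measure.isProbabilityMeasure_map ((measurable_from_top.comp_aemeasurable hK.aemeasurable).add hU)
    rw [mul_assoc]
    refine tvNorm_toSignedMeasure_sub_le fun B hB =>
      abs_measureReal_sub_le_of_continuous (fun h hc hb => ?_) hB
    rw [map_natCast_add_uniform_eq hK hU hU2 hKU]
    exact hmain r hr h hc hb
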